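/- Let $d\in\{2,3\}$, let $\Omega\subset\mathbb R^d$ be a bounded open connected polygonal (polyhedral) domain, and let $\Gamma=\bigcup_{j=1}^J\Gamma_j\Subset\Omega$ be a polygonal (polyhedral) interface that separates $\Omega$ into two disjoint nonempty open sets $\Omega_0,\Omega_1$ (so $\Omega\setminus\Gamma=\Omega_0\cup\Omega_1$, $\overline{\Omega}_0\cup\overline{\Omega}_1=\overline{\Omega}$ and $\Omega\cap\partial\Omega_0=\Omega\cap\partial\Omega_1=\Gamma$), where the sides $\Gamma_j$ are nondegenerate line segments if $d=2$ and planar polygons if $d=3$ (connected finite unions of nondegenerate coplanar triangles), any two of which overlap in a set of $(d-1)$-dimensional measure zero only. Let $C_\nu$ be a real constant and $m\ge 0$ an integer. For a partition $\mathcal T_h$ of $\Omega$ into finitely many nondegenerate triangles (tetrahedra) with pairwise disjoint interiors, let $h_K$ be the diameter of $K\in\mathcal T_h$, $\rho_K$ the radius of the largest ball inscribed in $K$, $\boldsymbol x_K$ the barycenter of $K$, $h=\max_K h_K$, $\rho=\min_K\rho_K$, and $B_{\tau(K)}=B(\boldsymbol x_K,h_K)$ the ball of center $\boldsymbol x_K$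 and radius $h_K$. For an element $K$ put $$\Gamma_K=\Gamma\cap K,\qquad \Gamma_{B_{\tau(K)}}=\bigcup_{j:\ \Gamma_j\cap K\neq\varnothing}\bigl(\Gamma_j\cap B_{\tau(K)}\bigr)\subset\Gamma\cap B_{\tau(K)} .$$ Then there are constants $h_1>0$ and $C>0$, depending only on $d$, $\Omega$, $\Gamma$ (with its sides), $C_\nu$ and $m$, such that for every such partition $\mathcal T_h$ with $h\le C_\nu\rho$ and $h<h_1$, every element $K\in\mathcal T_h$ with $K\cap\Gamma\neq\varnothing$, and every polynomial $w$ on $\mathbb R^d$ of total degree at most $m$, $$\|w\|_{L^\infty(\Gamma_K)}\le C\,h_K^{(1-d)/2}\,\|w\|_{L^2(\Gamma_{B_{\tau(K)}})},$$ where the norms are taken with respect to the $(d-1)$-dimensional surface measure. This holds both when the elements are understood as open simplices and when they are understood as closed simplices. -/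

import Mathlib

open MeasureTheory
open scoped ENNReal

noncomputable section

namespace UnfittedFEM

/-- Euclidean `d`-space. -/
abbrev E (d : ℕ) : Type := EuclideanSpace ℝ (Fin d)

/-- A flat `(d-1)`-dimensional side in `ℝ^d`: a connected subset of a hyperplane which is a finite
union of nondegenerate `(d-1)`-simplices (each given by `d` affinely independent vertices).
For `d = 2` these are exactly the nondegenerate line segments, for `d = 3` they are the planar
polygons, not necessarily convex and possibly with holes. -/
def IsSide {d : ℕ} (P : Set (E d)) : Prop :=
  IsConnected P ∧
  (∃ H : AffineSubspace ℝ (E d), Module.finrank ℝ H.direction + 1 = d ∧ P ⊆ (H : Set (E d))) ∧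
  ∃ S : Set (Fin d → E d), S.Finite ∧ (∀ v ∈ S, AffineIndependent ℝ v) ∧
    P = ⋃ v ∈ S, convexHull ℝ (Set.range v)

/-- A bounded polygonal (polyhedral) domain: open, connected, bounded, and with a boundary that is
a finite union of segments (polygons). -/
structure IsPolyhedralDomain {d : ℕ} (Ω : Set (E d)) : Prop where
  isOpen : IsOpen Ω
  isConnected : IsConnected Ω
  isBounded : Bornology.IsBounded Ω
  frontier_eq : ∃ F : Set (Set (E d)), F.Finite ∧ (∀ P ∈ F, IsSide P) ∧ frontier Ω = ⋃₀ F

/-- A polygonal (polyhedral) interface `Γ`, compactly contained in `Ω`, with its sides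
`Γ_1, …, Γ_J`, that separates `Ω` into the disjoint open sets `Ω₀` and `Ω₁`. -/
structure PolyhedralInterface {d : ℕ} (Ω : Set (E d)) where
  /-- the number of sides -/
  J : ℕ
  /-- the sides -/
  side : Fin J → Set (E d)
  isSide : ∀ j, IsSide (side j)
  /-- different sides overlap in a set of surface measure zero only -/
  side_inter : ∀ i j, i ≠ j → (μHE[d - 1] : Measure (E d)) (side i ∩ side j) = 0
  /-- as a finite union of compact sides, the interface is then compactly contained in `Ω` -/
  side_subset : ∀ j, side j ⊆ Ω
  Ω₀ : Set (E d)
  Ω₁ : Set (E d)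
  isOpen₀ : IsOpen Ω₀
  isOpen₁ : IsOpen Ω₁
  nonempty₀ : Ω₀.Nonempty
  nonempty₁ : Ω₁.Nonempty
  disjoint : Disjoint Ω₀ Ω₁
  closure_union : closure Ω₀ ∪ closure Ω₁ = closure Ω
  diff_eq : Ω \ (⋃ j, side j) = Ω₀ ∪ Ω₁
  frontier₀ : Ω ∩ frontier Ω₀ = ⋃ j, side j
  frontier₁ : Ω ∩ frontier Ω₁ = ⋃ j, side j

/-- The interface as a set, `Γ = ⋃ j, Γ_j`. -/
def PolyhedralInterface.Γ {d : ℕ} {Ω : Set (E d)} (I : PolyhedralInterface Ω) : Set (E d) :=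
  ⋃ j, I.side j

/-- The diameter `h_K` of a simplex. -/
def diamK {d : ℕ} (T : Affine.Simplex ℝ (E d) d) : ℝ := Metric.diam T.closedInterior

/-- The radius `ρ_K` of the largest ball inscribed in a simplex. -/
def inradiusK {d : ℕ} (T : Affine.Simplex ℝ (E d) d) : ℝ :=
  sSup {r : ℝ | ∃ c : E d, Metric.closedBall c r ⊆ T.closedInterior}

/-- A partition of `Ω` into finitely many nondegenerate simplices with pairwise disjoint
interiors. -/
structure Mesh {d : ℕ} (Ω : Set (E d)) where
  elems : Finset (Affine.Simplex ℝ (E d) d)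
  disjoint : ∀ T ∈ elems, ∀ T' ∈ elems, T ≠ T' → Disjoint T.interior T'.interior
  cover : ⋃ T ∈ elems, T.closedInterior = closure Ω

/-- The mesh size `h = max_K h_K`. -/
def Mesh.h {d : ℕ} {Ω : Set (E d)} (M : Mesh Ω) : ℝ := ⨆ T : M.elems, diamK T.1

/-- `ρ = min_K ρ_K`. -/
def Mesh.ρ {d : ℕ} {Ω : Set (E d)} (M : Mesh Ω) : ℝ := ⨅ T : M.elems, inradiusK T.1

/-- Quasi-uniformity with constant `Cν`: `h ≤ Cν ρ`. -/
def Mesh.IsQuasiUniform {d : ℕ} {Ω : Set (E d)} (M : Mesh Ω) (Cν : ℝ) : Prop := M.h ≤ Cν * M.ρ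

/-- The ball `B_τ(K) = B(x_K, h_K)` around the barycenter `x_K`. -/
def ballτ {d : ℕ} (T : Affine.Simplex ℝ (E d) d) : Set (E d) :=
  Metric.ball T.centroid (diamK T)

/-- `Γ_{B_τ(K)}`: the part in `B_τ(K)` of those sides of `Γ` that intersect the element. The
element is the set `K`, the open or the closed simplex `T`. -/
def PolyhedralInterface.Γτ {d : ℕ} {Ω : Set (E d)} (I : PolyhedralInterface Ω)
    (T : Affine.Simplex ℝ (E d) d) (K : Set (E d)) : Set (E d) :=
  ⋃ j ∈ {j | (I.side j ∩ K).Nonempty}, I.side j ∩ ballτ T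

/-- The norm of `w` in `L^p(S)` with respect to the `(d-1)`-dimensional surface measure. -/
def surfaceNorm {d : ℕ} (w : E d → ℝ) (p : ℝ≥0∞) (S : Set (E d)) : ℝ≥0∞ :=
  eLpNorm w p ((μHE[d - 1] : Measure (E d)).restrict S)

/-- The polynomial function on `ℝ^d` given by `p`. -/
def polyFun {d : ℕ} (p : MvPolynomial (Fin d) ℝ) : E d → ℝ :=
  fun x => MvPolynomial.eval (fun i => x i) p

end UnfittedFEM

end

open UnfittedFEM

/-! On a compact convex cell of dimension `n`, the polynomials of degree at most `m` form a
finite-dimensional space, on which the `L^q` norm is a norm because every point of the cell lies in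
the support of the `n`-dimensional Hausdorff measure; hence it bounds the maximum norm. Apply this
to `w ∘ φ`, where `φ` is the homothety with centre `x` and ratio `t ≤ 1`: it fixes `x`, preserves
the degree bound, maps the cell into itself and scales `n`-dimensional measure by `t ^ n`. This
bounds `|w x|` by `C t ^ (-n / q)` times the `L^q` norm of `w` over the part of the cell near `x`.
For `t` a small multiple of `h_K` that part lies in `B_τ(K)`, since `x` is at distance at most
`d / (d + 1) * h_K` from the barycenter.
-/

open Filter
open scoped NNReal

namespace UnfittedFEM

section HausdorffMeasure

variable {V : Type*} [NormedAddCommGroup V]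

section Compact

variable [InnerProductSpace ℝ V] [FiniteDimensional ℝ V] [MeasurableSpace V] [BorelSpace V]
  {n : ℕ} {s : Set V}

theorem euclideanHausdorffMeasure_lt_top_of_isCompact (hs : IsCompact s)
    (hn : Module.finrank ℝ (vectorSpan ℝ s) = n) : (μHE[n] : Measure V) s < ∞ := by
  rcases s.eq_empty_or_nonempty with rfl | ⟨x, hx⟩
  · simp
  let x' : affineSpan ℝ s := ⟨x, subset_affineSpan ℝ s hx⟩
  have hs' : IsCompact (Subtype.val ⁻¹' s : Set (affineSpan ℝ s)) :=
    (AffineSubspace.closed_of_finiteDimensional _).isClosedEmbedding_subtypeVal.isCompact_preimage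
      hs
  have : Nonempty (affineSpan ℝ s) := ⟨x'⟩
  have : IsFiniteMeasureOnCompacts (μHE[n] : Measure (affineSpan ℝ s)) := by
    rw [← hn, ← direction_affineSpan, EuclideanGeometry.euclideanHausdorffMeasure_eq x']
    exact Measure.IsFiniteMeasureOnCompacts.map _ (IsometryEquiv.vaddConst x').toHomeomorph
  rw [← Set.inter_eq_left.mpr (subset_affineSpan ℝ s), Set.inter_comm,
    ← Subtype.image_preimage_coe, AffineSubspace.euclideanHausdorffMeasure_coe_image]
  exact hs'.measure_lt_top

theorem euclideanHausdorffMeasure_pos_of_convex (hs : Convex ℝ s) (hne : s.Nonempty)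
    (hn : Module.finrank ℝ (vectorSpan ℝ s) = n) : 0 < (μHE[n] : Measure V) s := by
  obtain ⟨_, x, hx, -⟩ := hne.intrinsicInterior hs
  have : Nonempty (affineSpan ℝ s) := ⟨x⟩
  have : (μHE[n] : Measure (affineSpan ℝ s)).IsOpenPosMeasure := by
    rw [← hn, ← direction_affineSpan, EuclideanGeometry.euclideanHausdorffMeasure_eq x]
    let e := (IsometryEquiv.vaddConst x).toHomeomorph
    exact e.continuous.isOpenPosMeasure_map e.surjective
  calc 0 < (μHE[n] : Measure (affineSpan ℝ s)) (Subtype.val ⁻¹' s) :=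
        Measure.measure_pos_of_nonempty_interior _ ⟨x, hx⟩
    _ = μHE[n] (Subtype.val '' (Subtype.val ⁻¹' s : Set (affineSpan ℝ s))) :=
        (AffineSubspace.euclideanHausdorffMeasure_coe_image _ _ _).symm
    _ ≤ μHE[n] s := measure_mono (Set.image_preimage_subset _ _)

end Compact

section Homothety

variable [NormedSpace ℝ V] {s : Set V} {x : V} {t : ℝ}

theorem homothety_image_inter_ball_subset (hs : Convex ℝ s) (hx : x ∈ s) (ht₀ : 0 < t)
    (ht₁ : t ≤ 1) (r : ℝ) :
    AffineMap.homothety x t '' (s ∩ Metric.ball x r) ⊆ s ∩ Metric.ball x (t * r) := by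
  rintro _ ⟨y, ⟨hys, hyr⟩, rfl⟩
  constructor
  · rw [AffineMap.homothety_eq_lineMap]
    exact hs.lineMap_mem hx hys ⟨ht₀.le, ht₁⟩
  · rw [Metric.mem_ball, dist_homothety_center, Real.norm_of_nonneg ht₀.le, dist_comm]
    exact mul_lt_mul_of_pos_left hyr ht₀

variable [MeasurableSpace V] [BorelSpace V]

theorem subset_support_restrict_of_convex {n : ℕ} (hs : Convex ℝ s)
    (hpos : (μHE[n] : Measure V) s ≠ 0) :
    s ⊆ ((μHE[n] : Measure V).restrict s).support := by
  intro x hx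
  by_contra hsupp
  obtain ⟨U, hU, hU₀⟩ := Measure.notMem_support_iff_exists.mp hsupp
  obtain ⟨ε, hε, hεU⟩ := Metric.mem_nhds_iff.mp hU
  have hε₀ : (μHE[n] : Measure V) (s ∩ Metric.ball x ε) = 0 := by
    rw [Set.inter_comm, ← Measure.restrict_apply Metric.isOpen_ball.measurableSet]
    exact measure_mono_null hεU hU₀
  -- `s ∩ ball x ε` contains a shrunken copy of every bounded part of `s`.
  have hball : ∀ k : ℕ, (μHE[n] : Measure V) (s ∩ Metric.ball x ((k + 1) * ε)) = 0 := by
    intro k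
    have hk : (0 : ℝ) < (k + 1 : ℝ)⁻¹ := by positivity
    have hsub := homothety_image_inter_ball_subset hs hx hk
      (inv_le_one_of_one_le₀ (by linarith [k.cast_nonneg (α := ℝ)])) ((k + 1) * ε)
    rw [inv_mul_cancel_left₀ (by positivity)] at hsub
    have h := measure_mono_null hsub hε₀
    rw [euclideanHausdorffMeasure_homothety_image n x hk.ne'] at h
    exact (smul_eq_zero_iff_right (pow_ne_zero _ (nnnorm_ne_zero_iff.mpr hk.ne'))).mp h
  refine hpos (measure_mono_null (fun y hy => ?_) (measure_iUnion_null hball))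
  obtain ⟨k, hk⟩ := exists_nat_gt (dist y x / ε)
  refine Set.mem_iUnion.mpr ⟨k, hy, ?_⟩
  rw [Metric.mem_ball, ← div_lt_iff₀ hε]
  linarith

theorem measurableEmbedding_homothety (x : V) (ht : t ≠ 0) :
    MeasurableEmbedding (AffineMap.homothety x t) :=
  (Topology.IsOpenEmbedding.of_continuous_injective_isOpenMap
    (AffineMap.homothety_continuous x t)
    (AffineEquiv.homothetyUnitsMulHom x (Units.mk0 t ht)).injective
    (AffineMap.homothety_isOpenMap x t ht)).measurableEmbedding

theorem map_homothety_euclideanHausdorffMeasure (n : ℕ) (x : V) (ht : t ≠ 0) :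
    (μHE[n] : Measure V).map (AffineMap.homothety x t) = ‖t‖₊⁻¹ ^ n • μHE[n] := by
  refine Measure.ext fun s _ => ?_
  rw [(measurableEmbedding_homothety x ht).map_apply,
    euclideanHausdorffMeasure_homothety_preimage n x ht, Measure.smul_apply]

theorem eLpNorm_comp_homothety {F : Type*} [NormedAddCommGroup F] (n : ℕ) (x : V) (ht : 0 < t)
    (s : Set V) (q : ℝ≥0∞) (w : V → F) :
    eLpNorm (w ∘ AffineMap.homothety x t) q ((μHE[n] : Measure V).restrict s) =
      ENNReal.ofReal (t ^ (-(n * q⁻¹.toReal))) *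
        eLpNorm w q ((μHE[n] : Measure V).restrict (AffineMap.homothety x t '' s)) := by
  have hemb := measurableEmbedding_homothety x ht.ne'
  have hmap : ((μHE[n] : Measure V).restrict s).map (AffineMap.homothety x t) =
      ‖t‖₊⁻¹ ^ n • (μHE[n] : Measure V).restrict (AffineMap.homothety x t '' s) := by
    rw [← Measure.restrict_smul, ← map_homothety_euclideanHausdorffMeasure n x ht.ne',
      hemb.restrict_map, hemb.injective.preimage_image]
  have hscale : (‖t‖₊⁻¹ ^ n) ^ q⁻¹.toReal = (t ^ (-(n * q⁻¹.toReal))).toNNReal := by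
    ext
    rw [Real.coe_toNNReal _ (by positivity), NNReal.coe_rpow, NNReal.coe_pow, NNReal.coe_inv,
      coe_nnnorm, Real.norm_of_nonneg ht.le, ← Real.rpow_natCast, ← Real.rpow_mul (by positivity),
      Real.inv_rpow ht.le, Real.rpow_neg ht.le]
  rw [← hemb.eLpNorm_map_measure, hmap,
    eLpNorm_smul_measure_of_ne_zero' (pow_ne_zero _ (inv_ne_zero (nnnorm_ne_zero_iff.mpr ht.ne'))),
    ← ENNReal.toReal_inv, hscale]
  rfl

end Homothety

end HausdorffMeasure

theorem exists_enorm_le_mul_eLpNorm {X 𝕜 F : Type*} [TopologicalSpace X] [CompactSpace X]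
    [MeasurableSpace X] [BorelSpace X] [RCLike 𝕜] [NormedAddCommGroup F] [NormedSpace 𝕜 F]
    [SecondCountableTopologyEither X F] (ν : Measure X) [IsFiniteMeasure ν] [ν.IsOpenPosMeasure]
    {q : ℝ≥0∞} (hq : 1 ≤ q) (W : Submodule 𝕜 C(X, F)) [FiniteDimensional 𝕜 W] :
    ∃ C : ℝ≥0, ∀ f ∈ W, ‖f‖ₑ ≤ C * eLpNorm f q ν := by
  have : Fact (1 ≤ q) := ⟨hq⟩
  let N : W →ₗ[𝕜] Lp F q ν := (ContinuousMap.toLp q ν 𝕜).toLinearMap ∘ₗ W.subtype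
  have hN : LinearMap.ker N = ⊥ := LinearMap.ker_eq_bot.mpr
    ((ContinuousMap.toLp_injective (𝕜 := 𝕜) ν).comp Subtype.val_injective)
  obtain ⟨C, -, hC⟩ := N.exists_antilipschitzWith hN
  refine ⟨C, fun f hf => ?_⟩
  have hNf := hC ⟨f, hf⟩ 0
  rw [map_zero, edist_zero_right, edist_zero_right] at hNf
  calc ‖f‖ₑ ≤ C * ‖ContinuousMap.toLp (E := F) q ν 𝕜 f‖ₑ := hNf
    _ = C * eLpNorm f q ν := by
        rw [Lp.enorm_def, eLpNorm_congr_ae (ContinuousMap.coeFn_toLp ν f)]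

theorem continuous_polyFun {d : ℕ} (p : MvPolynomial (Fin d) ℝ) : Continuous (polyFun p) :=
  (MvPolynomial.continuous_eval p).comp (by fun_prop)

/-- Restriction of polynomial functions to `σ`, as a linear map into `C(σ, ℝ)`: it presents the
polynomial functions of bounded degree on `σ` as a finite-dimensional space. -/
noncomputable def polyFunRestrict {d : ℕ} (σ : Set (E d)) :
    MvPolynomial (Fin d) ℝ →ₗ[ℝ] C(σ, ℝ) where
  toFun p := ⟨fun x => polyFun p x, (continuous_polyFun p).comp continuous_subtype_val⟩
  map_add' p q := by ext; simp [polyFun]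
  map_smul' c p := by ext; simp [polyFun]

theorem exists_enorm_polyFun_le {d : ℕ} (m : ℕ) {q : ℝ≥0∞} (hq : 1 ≤ q) {μ : Measure (E d)}
    {σ : Set (E d)} (hσ : IsCompact σ) (hfin : μ σ ≠ ∞) (hsupp : σ ⊆ (μ.restrict σ).support) :
    ∃ C : ℝ≥0, ∀ p : MvPolynomial (Fin d) ℝ, p.totalDegree ≤ m → ∀ x ∈ σ,
      ‖polyFun p x‖ₑ ≤ C * eLpNorm (polyFun p) q (μ.restrict σ) := by
  have hemb := MeasurableEmbedding.subtype_coe hσ.measurableSet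
  have : CompactSpace σ := isCompact_iff_compactSpace.mp hσ
  let ν : Measure σ := μ.comap Subtype.val
  have : IsFiniteMeasure ν := ⟨by
    rw [hemb.comap_apply, Set.image_univ, Subtype.range_coe]
    exact hfin.lt_top⟩
  have : ν.IsOpenPosMeasure := ⟨by
    rintro _ ⟨U, hU, rfl⟩ ⟨x, hx⟩
    rw [hemb.comap_apply, Subtype.image_preimage_coe, Set.inter_comm,
      ← Measure.restrict_apply hU.measurableSet]
    exact ((Measure.mem_support_iff_forall _).mp (hsupp x.2) U (hU.mem_nhds hx)).ne'⟩
  obtain ⟨C, hC⟩ := exists_enorm_le_mul_eLpNorm ν hq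
    ((MvPolynomial.restrictTotalDegree (Fin d) ℝ m).map (polyFunRestrict σ))
  refine ⟨C, fun p hp x hx => ?_⟩
  calc ‖polyFun p x‖ₑ ≤ ‖polyFunRestrict σ p‖ₑ :=
        enorm_le_iff_norm_le.mpr ((polyFunRestrict σ p).norm_coe_le_norm ⟨x, hx⟩)
    _ ≤ C * eLpNorm (polyFunRestrict σ p) q ν :=
        hC _ ⟨p, (MvPolynomial.mem_restrictTotalDegree _ _ _).mpr hp, rfl⟩
    _ = C * eLpNorm (polyFun p) q (μ.restrict σ) := by
        rw [show μ.restrict σ = ν.map Subtype.val by rw [hemb.map_comap, Subtype.range_coe],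
          hemb.eLpNorm_map_measure]
        rfl

theorem totalDegree_bind₁_le {σ τ R : Type*} [CommSemiring R] {f : σ → MvPolynomial τ R}
    (hf : ∀ i, (f i).totalDegree ≤ 1) (p : MvPolynomial σ R) :
    (MvPolynomial.bind₁ f p).totalDegree ≤ p.totalDegree := by
  rw [← MvPolynomial.aeval_eq_bind₁, MvPolynomial.aeval_def, MvPolynomial.eval₂_eq]
  refine MvPolynomial.totalDegree_finsetSum_le fun s hs => ?_
  calc (algebraMap R _ (p.coeff s) * ∏ i ∈ s.support, f i ^ s i).totalDegree
      ≤ (algebraMap R (MvPolynomial τ R) (p.coeff s)).totalDegree +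
          (∏ i ∈ s.support, f i ^ s i).totalDegree := MvPolynomial.totalDegree_mul _ _
    _ = (∏ i ∈ s.support, f i ^ s i).totalDegree := by
        rw [MvPolynomial.algebraMap_eq, MvPolynomial.totalDegree_C, zero_add]
    _ ≤ ∑ i ∈ s.support, (f i ^ s i).totalDegree := MvPolynomial.totalDegree_finsetProd _ _
    _ ≤ ∑ i ∈ s.support, s i := Finset.sum_le_sum fun i _ =>
        (MvPolynomial.totalDegree_pow _ _).trans (mul_le_of_le_one_right' (hf i))
    _ ≤ p.totalDegree := MvPolynomial.le_totalDegree hs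

theorem exists_polyFun_comp_affineMap {d e : ℕ} (f : E d →ᵃ[ℝ] E e)
    (p : MvPolynomial (Fin e) ℝ) :
    ∃ q : MvPolynomial (Fin d) ℝ, q.totalDegree ≤ p.totalDegree ∧
      polyFun q = polyFun p ∘ f := by
  let b := EuclideanSpace.basisFun (Fin d) ℝ
  let g : Fin e → MvPolynomial (Fin d) ℝ := fun i =>
    MvPolynomial.C (f 0 i) + ∑ j, MvPolynomial.C (f.linear (b j) i) * MvPolynomial.X j
  have hg : ∀ i, (g i).totalDegree ≤ 1 := fun i =>
    (MvPolynomial.totalDegree_add _ _).trans <| max_le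
      (by rw [MvPolynomial.totalDegree_C]; exact zero_le_one)
      (MvPolynomial.totalDegree_finsetSum_le fun j _ =>
        (MvPolynomial.totalDegree_mul _ _).trans (by simp))
  have hfg : ∀ y : E d, (fun i => f y i) = fun i => MvPolynomial.eval (fun j => y j) (g i) := by
    intro y
    funext i
    have hy : f.linear y = ∑ j, y j • f.linear (b j) := by
      conv_lhs => rw [← b.sum_repr y, map_sum]
      simp [b]
    rw [f.decomp]
    simp [hy, g, mul_comm, add_comm]
  refine ⟨MvPolynomial.bind₁ g p, totalDegree_bind₁_le hg p, funext fun y => ?_⟩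
  simp only [polyFun, Function.comp_apply, hfg]
  exact MvPolynomial.eval₂Hom_bind₁ (RingHom.id ℝ) (fun i => y i) g p

theorem eLpNorm_top_restrict_le {X F : Type*} [TopologicalSpace X] [MeasurableSpace X]
    [OpensMeasurableSpace X] [NormedAddCommGroup F] {μ : Measure X} {w : X → F}
    (hw : Continuous w) {S : Set X} {c : ℝ≥0∞} (h : ∀ x ∈ S, ‖w x‖ₑ ≤ c) :
    eLpNorm w ⊤ (μ.restrict S) ≤ c := by
  rw [eLpNorm_exponent_top]
  refine eLpNormEssSup_le_of_ae_enorm_bound ?_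
  rw [ae_restrict_iff (isClosed_le hw.enorm continuous_const).measurableSet]
  exact ae_of_all _ h

section LocalInverseEstimate

variable {d n m : ℕ} {q : ℝ≥0∞} {H : ℝ}

/-- A compact convex set of affine dimension `n` in `ℝ^d`, for instance an `n`-simplex. -/
structure IsConvexBody (n : ℕ) (σ : Set (E d)) : Prop where
  isCompact : IsCompact σ
  convex : Convex ℝ σ
  finrank_vectorSpan : Module.finrank ℝ (vectorSpan ℝ σ) = n

/-- A finite union of `n`-dimensional compact convex sets: the common generalization of the sides of
a polyhedral interface that the inverse estimate needs. The pieces may overlap. -/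
def IsConvexBodyUnion (n : ℕ) (P : Set (E d)) : Prop :=
  ∃ F : Set (Set (E d)), F.Finite ∧ (∀ σ ∈ F, IsConvexBody n σ) ∧ P = ⋃₀ F

/-- The inverse estimate with constant `C` for polynomials of degree at most `m` at the points of
`P`, on all scales `r ≤ H`, with respect to `n`-dimensional measure. The exponent `1 / q` is written
as `q⁻¹.toReal`, so that it is `0` for `q = ∞`. -/
def LocalInverseEstimate (n m : ℕ) (q : ℝ≥0∞) (H C : ℝ) (P : Set (E d)) : Prop :=
  ∀ p : MvPolynomial (Fin d) ℝ, p.totalDegree ≤ m → ∀ x ∈ P, ∀ r, 0 < r → r ≤ H →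
    ‖polyFun p x‖ₑ ≤ ENNReal.ofReal (C * r ^ (-(n * q⁻¹.toReal))) *
      eLpNorm (polyFun p) q ((μHE[n] : Measure (E d)).restrict (P ∩ Metric.ball x r))

theorem IsSide.isConvexBodyUnion {P : Set (E d)} (hP : IsSide P) :
    IsConvexBodyUnion (d - 1) P := by
  obtain ⟨-, ⟨A, hA, -⟩, S, hS, hind, rfl⟩ := hP
  refine ⟨(fun v => convexHull ℝ (Set.range v)) '' S, hS.image _, ?_, (Set.sUnion_image _ _).symm⟩
  rintro _ ⟨v, hv, rfl⟩
  refine ⟨(Set.finite_range v).isCompact_convexHull ℝ, convex_convexHull ℝ _, ?_⟩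
  rw [← direction_affineSpan, affineSpan_convexHull, direction_affineSpan]
  exact (hind v hv).finrank_vectorSpan (by rw [Fintype.card_fin]; omega)

theorem LocalInverseEstimate.mono {C C' : ℝ} {P : Set (E d)}
    (h : LocalInverseEstimate n m q H C P) (hC : C ≤ C') : LocalInverseEstimate n m q H C' P := by
  intro p hp x hx r hr hrH
  refine (h p hp x hx r hr hrH).trans ?_
  gcongr

theorem LocalInverseEstimate.sUnion {C : ℝ} {F : Set (Set (E d))}
    (h : ∀ σ ∈ F, LocalInverseEstimate n m q H C σ) : LocalInverseEstimate n m q H C (⋃₀ F) := by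
  rintro p hp x ⟨σ, hσ, hx⟩ r hr hrH
  refine (h σ hσ p hp x hx r hr hrH).trans ?_
  gcongr
  exact Set.subset_sUnion_of_mem hσ

theorem IsConvexBody.exists_localInverseEstimate {σ : Set (E d)} (hσ : IsConvexBody n σ) (m : ℕ)
    (hq : 1 ≤ q) (H : ℝ) : ∃ C, LocalInverseEstimate n m q H C σ := by
  obtain ⟨C, hC⟩ := exists_enorm_polyFun_le m hq hσ.isCompact
    (euclideanHausdorffMeasure_lt_top_of_isCompact hσ.isCompact hσ.finrank_vectorSpan).ne
    fun x hx => subset_support_restrict_of_convex hσ.convex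
      (euclideanHausdorffMeasure_pos_of_convex hσ.convex ⟨x, hx⟩ hσ.finrank_vectorSpan).ne' hx
  set L : ℝ := max H (Metric.diam σ + 1)
  set a : ℝ := -(n * q⁻¹.toReal)
  have hL : 0 < L := lt_max_of_lt_right (by positivity)
  refine ⟨C * L⁻¹ ^ a, fun p hp x hx r hr hrH => ?_⟩
  have hball : σ ∩ Metric.ball x L = σ := Set.inter_eq_left.mpr fun y hy =>
    (Metric.dist_le_diam_of_mem hσ.isCompact.isBounded hy hx).trans_lt
      (lt_max_of_lt_right (lt_add_one _))
  have hsub : AffineMap.homothety x (r / L) '' σ ⊆ σ ∩ Metric.ball x r := by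
    have h := homothety_image_inter_ball_subset hσ.convex hx (div_pos hr hL)
      ((div_le_one hL).mpr (hrH.trans (le_max_left _ _))) L
    rwa [hball, div_mul_cancel₀ _ hL.ne'] at h
  obtain ⟨p', hp', hpp'⟩ := exists_polyFun_comp_affineMap (AffineMap.homothety x (r / L)) p
  calc ‖polyFun p x‖ₑ = ‖polyFun p' x‖ₑ := by
        rw [hpp', Function.comp_apply, AffineMap.homothety_apply_same]
    _ ≤ C * eLpNorm (polyFun p') q (μHE[n].restrict σ) := hC p' (hp'.trans hp) x hx
    _ = ENNReal.ofReal (C * L⁻¹ ^ a * r ^ a) * eLpNorm (polyFun p) q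
          (μHE[n].restrict (AffineMap.homothety x (r / L) '' σ)) := by
        rw [hpp', eLpNorm_comp_homothety n x (div_pos hr hL), ← mul_assoc, div_eq_inv_mul,
          Real.mul_rpow (by positivity) hr.le, mul_assoc (C : ℝ),
          ENNReal.ofReal_mul C.coe_nonneg, ENNReal.ofReal_coe_nnreal]
    _ ≤ ENNReal.ofReal (C * L⁻¹ ^ a * r ^ a) *
          eLpNorm (polyFun p) q (μHE[n].restrict (σ ∩ Metric.ball x r)) := by gcongr

theorem IsConvexBodyUnion.eventually_localInverseEstimate {P : Set (E d)}
    (hP : IsConvexBodyUnion n P) (m : ℕ) (hq : 1 ≤ q) (H : ℝ) :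
    ∀ᶠ C in atTop, LocalInverseEstimate n m q H C P := by
  obtain ⟨F, hF, hbody, rfl⟩ := hP
  have hcell : ∀ σ ∈ F, ∀ᶠ C in atTop, LocalInverseEstimate n m q H C σ := fun σ hσ => by
    obtain ⟨C, hC⟩ := (hbody σ hσ).exists_localInverseEstimate m hq H
    exact (eventually_ge_atTop C).mono fun _ => hC.mono
  exact ((eventually_all_finite hF).mpr hcell).mono fun _ => LocalInverseEstimate.sUnion

end LocalInverseEstimate

theorem dist_centroid_le {V : Type*} [NormedAddCommGroup V] [NormedSpace ℝ V] {n : ℕ}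
    (T : Affine.Simplex ℝ V n) {x : V} (hx : x ∈ T.closedInterior) :
    dist x T.centroid ≤ n / (n + 1) * Metric.diam T.closedInterior := by
  have hvertex : ∀ i, dist (T.points i) T.centroid ≤
      n / (n + 1) * Metric.diam T.closedInterior := by
    intro i
    have hsum : ‖∑ j, (T.points j -ᵥ T.points i)‖ ≤ n * Metric.diam T.closedInterior := by
      rw [← Finset.sum_erase Finset.univ (a := i) (vsub_self _)]
      refine (norm_sum_le_of_le (n := fun _ => Metric.diam T.closedInterior) _
        fun j _ => ?_).trans_eq (by simp)
      rw [← dist_eq_norm_vsub]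
      exact Metric.dist_le_diam_of_mem T.isCompact_closedInterior.isBounded
        (T.point_mem_closedInterior j) (T.point_mem_closedInterior i)
    rw [← T.smul_centroid_vsub_point_eq_sum_vsub i, norm_smul, ← dist_eq_norm_vsub,
      Real.norm_of_nonneg (by positivity)] at hsum
    rw [dist_comm, div_mul_eq_mul_div, le_div_iff₀ (by positivity)]
    linarith
  have hsub : convexHull ℝ (Set.range T.points) ⊆
      Metric.closedBall T.centroid (n / (n + 1) * Metric.diam T.closedInterior) :=
    convexHull_min (Set.range_subset_iff.mpr hvertex) (convex_closedBall _ _)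
  exact hsub (T.convexHull_eq_closedInterior ▸ hx)

theorem diamK_pos {d : ℕ} (hd : 0 < d) (T : Affine.Simplex ℝ (E d) d) : 0 < diamK T := by
  obtain ⟨d, rfl⟩ := Nat.exists_eq_succ_of_ne_zero hd.ne'
  exact (dist_pos.mpr (T.independent.injective.ne Fin.zero_ne_one)).trans_le
    (Metric.dist_le_diam_of_mem T.isCompact_closedInterior.isBounded
      (T.point_mem_closedInterior 0) (T.point_mem_closedInterior 1))

theorem Mesh.diamK_le_h {d : ℕ} {Ω : Set (E d)} (M : Mesh Ω) {T : Affine.Simplex ℝ (E d) d}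
    (hT : T ∈ M.elems) : diamK T ≤ M.h :=
  le_ciSup (f := fun T : M.elems => diamK T.1) (Set.finite_range _).bddAbove ⟨T, hT⟩

theorem ball_subset_ballτ {d : ℕ} (T : Affine.Simplex ℝ (E d) d) {x : E d}
    (hx : x ∈ T.closedInterior) :
    Metric.ball x (diamK T / (d + 1)) ⊆ ballτ T := by
  refine Metric.ball_subset_ball' ?_
  calc diamK T / (d + 1) + dist x T.centroid
      ≤ diamK T / (d + 1) + d / (d + 1) * diamK T := by gcongr; exact dist_centroid_le T hx
    _ = diamK T := by field_simp; ring

end UnfittedFEM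

theorem mainTheorem4_general {ι : Type*} [Finite ι] {d n : ℕ} (hd : 0 < d) {side : ι → Set (E d)}
    (hside : ∀ j, IsConvexBodyUnion n (side j)) (m : ℕ) {q : ℝ≥0∞} (hq : 1 ≤ q) (H : ℝ) :
    ∃ C : ℝ, 0 < C ∧ ∀ T : Affine.Simplex ℝ (E d) d, diamK T ≤ H → ∀ K ⊆ T.closedInterior,
      ∀ p : MvPolynomial (Fin d) ℝ, p.totalDegree ≤ m →
        eLpNorm (polyFun p) ⊤ ((μHE[n] : Measure (E d)).restrict ((⋃ j, side j) ∩ K)) ≤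
          ENNReal.ofReal (C * diamK T ^ (-(n * q⁻¹.toReal))) *
            eLpNorm (polyFun p) q ((μHE[n] : Measure (E d)).restrict
              (⋃ j ∈ {j | (side j ∩ K).Nonempty}, side j ∩ ballτ T)) := by
  obtain ⟨C, hC₀, hC⟩ := ((eventually_gt_atTop 0).and (eventually_all.mpr fun j =>
    (hside j).eventually_localInverseEstimate m hq H)).exists
  set a : ℝ := -(n * q⁻¹.toReal)
  refine ⟨C * ((d : ℝ) + 1)⁻¹ ^ a, by positivity, fun T hT K hK p hp => ?_⟩
  have hdiam := diamK_pos hd T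
  refine eLpNorm_top_restrict_le (continuous_polyFun p) ?_
  rintro x ⟨hx, hxK⟩
  obtain ⟨j, hj⟩ := Set.mem_iUnion.mp hx
  have hle : diamK T / (d + 1) ≤ diamK T := div_le_self hdiam.le (by simp)
  calc ‖polyFun p x‖ₑ ≤ ENNReal.ofReal (C * (diamK T / (d + 1)) ^ a) * eLpNorm (polyFun p) q
          (μHE[n].restrict (side j ∩ Metric.ball x (diamK T / (d + 1)))) :=
        hC j p hp x hj _ (by positivity) (hle.trans hT)
    _ = ENNReal.ofReal (C * ((d : ℝ) + 1)⁻¹ ^ a * diamK T ^ a) * eLpNorm (polyFun p) q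
          (μHE[n].restrict (side j ∩ Metric.ball x (diamK T / (d + 1)))) := by
        rw [div_eq_inv_mul, Real.mul_rpow (by positivity) hdiam.le, mul_assoc C]
    _ ≤ _ := by
        gcongr
        exact (Set.inter_subset_inter_right _ (ball_subset_ballτ T (hK hxK))).trans
          (Set.subset_biUnion_of_mem (u := fun j => side j ∩ ballτ T) ⟨x, hj, hxK⟩)

theorem mainTheorem4 (d : ℕ) (hd : d = 2 ∨ d = 3) (Ω : Set (E d)) (hΩ : IsPolyhedralDomain Ω)
    (I : PolyhedralInterface Ω) (Cν : ℝ) (m : ℕ) :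
    ∃ h₁ : ℝ, 0 < h₁ ∧ ∃ C : ℝ, 0 < C ∧
      ∀ M : Mesh Ω, M.IsQuasiUniform Cν → M.h < h₁ →
        ∀ T ∈ M.elems, ∀ K : Set (E d), (K = T.interior ∨ K = T.closedInterior) →
          (K ∩ I.Γ).Nonempty →
            ∀ p : MvPolynomial (Fin d) ℝ, p.totalDegree ≤ m →
              surfaceNorm (polyFun p) ⊤ (I.Γ ∩ K) ≤
                ENNReal.ofReal (C * diamK T ^ ((1 - (d : ℝ)) / 2)) *
                  surfaceNorm (polyFun p) 2 (I.Γτ T K) := by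
  have hd₀ : 0 < d := by omega
  have hexp : (1 - (d : ℝ)) / 2 = -((d - 1 : ℕ) * (2 : ℝ≥0∞)⁻¹.toReal) := by
    rw [Nat.cast_pred hd₀, ENNReal.toReal_inv, ENNReal.toReal_ofNat]
    ring
  obtain ⟨C, hC₀, hC⟩ := mainTheorem4_general hd₀ (fun j => (I.isSide j).isConvexBodyUnion) m
    one_le_two 1
  refine ⟨1, one_pos, C, hC₀, fun M _ hM T hT K hK _ => ?_⟩
  exact hexp ▸ hC T ((M.diamK_le_h hT).trans hM.le) K
    (hK.elim (·.trans_subset T.interior_subset_closedInterior) (·.subset))
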